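/- A distance space is a set $X$ with a function $d:X\times X\to[0,\infty]$ that satisfies the axioms of a metric, except that the value $\infty$ is allowed; it carries the topology generated by its open balls. A distance measure space $(X,d,\mu)$ is a distance space with a finite Borel measure $\mu$ (such a measure is automatically regular: outer regular with respect to open sets and inner regular with respect to closed sets). For $L>0$ and $\varepsilon\ge 0$, a (Borel measurable) map $\iota$ from a distance measure space $(M,d,\mu)$ to a distance space $(N,d')$ is an $L$-isometric $\varepsilon$-embedding if there is $E\subset M$ with $\mu(E)\le\varepsilon$ such that, for all $x,y\in M\setminus E$, $d'(\iota(x),\iota(y))=d(x,y)$ whenever $\min\{d'(\iota(x),\iota(y)),d(x,y)\}<L$. For finite Borel measures $\alpha,\beta$ on a distance space, let $d_\pi(\alpha,\beta)$ be the infimum of all $\varepsilon>0$ such that $\alpha(A)\le\beta(A^\varepsilon)+\varepsilon$ and $\beta(A)\le\alpha(A^\varepsilon)+\varepsilon$ for all Borel sets $A$, where $A^\varepsilon$ is the set of points at distance less than $\varepsilon$ from some point of $A$. The generalised Gromov-Hausdorff-Levy-Prokhorov distance is $$d_\rho\big((X_1,d_1,\mu_1),(X_2,d_2,\mu_2)\big)=\inf\Big\{d_\pi\big((\iota_1)_*\mu_1,(\iota_2)_*\mu_2\big)+\tfrac1L+\varepsilon\Big\},$$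 the infimum being over all distance spaces $Z$, all real $L>0$ and $\varepsilon\ge0$, and all $L$-isometric $\varepsilon$-embeddings $\iota_i:X_i\to Z$, $i=1,2$. A measure preserving isometry from $(X,d_X,\mu)$ to $(Y,d_Y,\nu)$ is a map $f:X\to Y$ with $d_Y(f(x),f(x'))=d_X(x,x')$ for all $x,x'\in X$ and $\mu(f^{-1}(B))=\nu(B)$ for all Borel sets $B\subset Y$. **Proposition.** Let $(X,d_X,\mu)$ and $(Y,d_Y,\nu)$ be complete separable distance measure spaces, and let $(X^n,d_{X^n},\mu^n)$ and $(Y^n,d_{Y^n},\nu^n)$, $n\in\mathbb N$, be distance measure spaces with $d_\rho(X^n,X)\to0$ and $d_\rho(Y^n,Y)\to0$. Suppose that for every $n$ there is given a measure preserving isometry $f^n:X^n\to Y^n$. Then there are a Borel set $\underline X\subset X$ with $\mu(\underline X)=0$ and a measure preserving isometry $f:X\setminus\underline X\to Y$, where $X\setminus\underline X$ carries the restrictions of $d_X$ and $\mu$. -/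

import Mathlib

open MeasureTheory Filter Topology
open scoped NNReal ENNReal

/-!
A distance space (a metric space in which distances may be infinite) is an `EMetricSpace`; a distance
measure space is an `EMetricSpace` with its Borel σ-algebra and a finite measure. Such a measure
is automatically regular (outer by open sets, inner by closed sets).
-/

/-- The restriction of `i` to `S` is an `L`-isometric embedding: two points of `S` keep their
distance as soon as the distance before or after applying `i` is less than `L`. -/
def IsLIsometricOn {M N : Type*} [EMetricSpace M] [EMetricSpace N]
    (L : ℝ≥0) (i : M → N) (S : Set M) : Prop :=
  ∀ x ∈ S, ∀ y ∈ S,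
    min (edist (i x) (i y)) (edist x y) < (L : ℝ≥0∞) → edist (i x) (i y) = edist x y

/-- `i` is an `L`-isometric `ε`-embedding of `(M, d, μ)` into the distance space `N`: it is a
measurable map (so that it has a push-forward measure), and it is an `L`-isometric embedding away
from a set of measure at most `ε`. -/
def IsLIsometricEpsEmbedding {M N : Type*} [EMetricSpace M] [MeasurableSpace M]
    [EMetricSpace N] [MeasurableSpace N] (μ : Measure M) (L ε : ℝ≥0) (i : M → N) : Prop :=
  Measurable i ∧ ∃ E : Set M, μ E ≤ ε ∧ IsLIsometricOn L i Eᶜ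

universe u v

/-- The generalised Gromov-Hausdorff-Levy-Prokhorov distance `d_ρ`: the infimum of
`d_π((ι₁)_* μ₁, (ι₂)_* μ₂) + 1 / L + ε` over all distance spaces `Z` (with their Borel σ-algebra),
all real `L > 0` and `ε ≥ 0`, and all `L`-isometric `ε`-embeddings `ι₁ : X₁ → Z`, `ι₂ : X₂ → Z`,
where `d_π` is the Levy-Prokhorov distance. -/
noncomputable def dRho {X₁ : Type u} {X₂ : Type v}
    [EMetricSpace X₁] [MeasurableSpace X₁] [EMetricSpace X₂] [MeasurableSpace X₂]
    (μ₁ : Measure X₁) (μ₂ : Measure X₂) : ℝ≥0∞ :=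
  sInf {r : ℝ≥0∞ | ∃ (Z : Type (max u v)) (_ : EMetricSpace Z) (_ : MeasurableSpace Z)
    (_ : BorelSpace Z) (L ε : ℝ≥0) (ι₁ : X₁ → Z) (ι₂ : X₂ → Z),
    0 < L ∧ IsLIsometricEpsEmbedding μ₁ L ε ι₁ ∧ IsLIsometricEpsEmbedding μ₂ L ε ι₂ ∧
    r = levyProkhorovEDist (μ₁.map ι₁) (μ₂.map ι₂) + 1 / (L : ℝ≥0∞) + (ε : ℝ≥0∞)}

open Set

/-! A small `dRho` gives embeddings into a common space `Z`. Declare `p` and `a` matched when their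
images in `Z` are close and `a` is not exceptional; `IsApproxMatching` keeps just the consequences
of this, and `Z` can be forgotten. Through `f n`, the matchings correlate points of `X` with points
of `Y`. Along a nonprincipal ultrafilter, `limitRelation` collects the pairs near which the
correlated mass does not vanish. It is closed, and it preserves distances because non-vanishing mass
outweighs the exceptional sets.

A compact rectangle `C ×ˢ K` avoiding the relation correlates asymptotically no mass, which forces
`μ C + ν K ≤ ν univ`. By inner regularity of `ν`, `μ C` is at most the `ν`-measure of the section
over `C`. Hence the relation has conull domain and is the graph of an isometry whose push-forward of
`μ` is dominated by `ν`; comparing total masses gives equality. -/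

/-- The relation `N` between `X'` and `X` matches the measure `μ'` with `μ` up to an error
controlled by `s`, and, outside the exceptional set `E`, distances below `1 / s` as well. -/
structure IsApproxMatching {X' X : Type*} [EMetricSpace X'] [MeasurableSpace X'] [EMetricSpace X]
    [MeasurableSpace X] (s : ℝ≥0∞) (μ' : Measure X') (μ : Measure X) (N : X' → X → Prop)
    (E : Set X') : Prop where
  measurableSet_bad : MeasurableSet E
  measure_bad_le : μ' E ≤ s
  measurableSet_matched : ∀ U : Set X, MeasurableSet {p | ∃ a ∈ U, N p a}
  measure_le_matched : ∀ U : Set X, μ U ≤ μ' {p | ∃ a ∈ U, N p a} + 2 * s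
  measure_univ_le : μ' univ ≤ μ univ + s
  edist_le_left : ∀ p q a b, p ∉ E → q ∉ E → N p a → N q b → ∀ D, D + 4 * s < s⁻¹ →
    edist a b ≤ D → edist p q ≤ D + 4 * s
  edist_le_right : ∀ p q a b, p ∉ E → q ∉ E → N p a → N q b → ∀ D, D + 4 * s < s⁻¹ →
    edist p q ≤ D → edist a b ≤ D + 4 * s

theorem exists_isApproxMatching_of_dRho_lt {X' X : Type*} [EMetricSpace X'] [MeasurableSpace X']
    [EMetricSpace X] [MeasurableSpace X] {μ' : Measure X'} {μ : Measure X} {s : ℝ≥0∞}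
    (hs : s ≠ ∞) (h : dRho μ' μ < s) : ∃ N E, IsApproxMatching s μ' μ N E := by
  obtain ⟨r, ⟨Z, _, _, _, L, ε, i, j, hL, ⟨hi, E, hE, hiE⟩, ⟨hj, F, hF, hjF⟩, rfl⟩, hr⟩ :=
    sInf_lt_iff.1 h
  have hlp : levyProkhorovEDist (μ'.map i) (μ.map j) < s :=
    (le_self_add.trans le_self_add).trans_lt hr
  have hLs : s⁻¹ < (L : ℝ≥0∞) := by
    rw [ENNReal.inv_lt_iff_inv_lt, ← one_div]
    exact (le_add_self.trans le_self_add).trans_lt hr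
  have hεs : (ε : ℝ≥0∞) ≤ s := le_add_self.trans hr.le
  have h2s : (2 * s) ≠ ∞ := ENNReal.mul_ne_top (by simp) hs
  have hset : ∀ U : Set X, {p | ∃ a ∈ U, a ∉ F ∧ edist (i p) (j a) < 2 * s} =
      i ⁻¹' Metric.thickening (2 * s).toReal (j '' (U \ F)) := by
    intro U
    ext p
    simp only [mem_ofPred_eq, mem_preimage, Metric.mem_thickening_iff_exists_edist_lt,
      ENNReal.ofReal_toReal h2s, exists_mem_image, Set.mem_sdiff, and_assoc]
  have htri : ∀ {p q a b}, edist (i p) (j a) < 2 * s → edist (i q) (j b) < 2 * s →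
      edist (i p) (i q) ≤ edist (j a) (j b) + 4 * s ∧
      edist (j a) (j b) ≤ edist (i p) (i q) + 4 * s := by
    intro p q a b hp hq
    have h4 : 4 * s = 2 * s + 2 * s := by ring
    constructor
    · calc edist (i p) (i q) ≤ edist (i p) (j a) + edist (j a) (j b) + edist (j b) (i q) :=
            edist_triangle4 _ _ _ _
        _ ≤ 2 * s + edist (j a) (j b) + 2 * s := by
            rw [edist_comm (j b)]; gcongr
        _ = _ := by rw [h4]; ring
    · calc edist (j a) (j b) ≤ edist (j a) (i p) + edist (i p) (i q) + edist (i q) (j b) :=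
            edist_triangle4 _ _ _ _
        _ ≤ 2 * s + edist (i p) (i q) + 2 * s := by
            rw [edist_comm (j a)]; gcongr
        _ = _ := by rw [h4]; ring
  -- The radius is `2 * s`: one `s` opens up the image of an arbitrary `U` so that the
  -- Levy-Prokhorov inequality applies, the other is its thickening. `E` need not be measurable,
  -- hence its measurable hull.
  refine ⟨fun p a => a ∉ F ∧ edist (i p) (j a) < 2 * s, toMeasurable μ' E,
    measurableSet_toMeasurable _ _, ?_, ?_, ?_, ?_, ?_, ?_⟩
  · rw [measure_toMeasurable]
    exact hE.trans hεs
  · intro U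
    rw [hset]
    exact hi Metric.isOpen_thickening.measurableSet
  · intro U
    rw [hset]
    set B := Metric.thickening s.toReal (j '' (U \ F)) with hB
    have hBo : IsOpen B := Metric.isOpen_thickening
    have hs0 : 0 < s.toReal := ENNReal.toReal_pos (bot_le.trans_lt h).ne' hs
    have hsub : U \ F ⊆ j ⁻¹' B := fun x hx =>
      Metric.self_subset_thickening hs0 _ (mem_image_of_mem j hx)
    have hth : Metric.thickening s.toReal B ⊆
        Metric.thickening (2 * s).toReal (j '' (U \ F)) := by
      refine (Metric.thickening_thickening_subset _ _ _).trans_eq ?_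
      rw [two_mul, ENNReal.toReal_add hs hs]
    calc μ U ≤ μ (U \ F ∪ F) := measure_mono (by simp)
      _ ≤ μ (U \ F) + μ F := measure_union_le _ _
      _ ≤ μ (j ⁻¹' B) + s := add_le_add (measure_mono hsub) (hF.trans hεs)
      _ = μ.map j B + s := by rw [Measure.map_apply hj hBo.measurableSet]
      _ ≤ (μ'.map i (Metric.thickening s.toReal B) + s) + s := by
          gcongr
          exact right_measure_le_of_levyProkhorovEDist_lt hlp hBo.measurableSet
      _ ≤ (μ'.map i (Metric.thickening (2 * s).toReal (j '' (U \ F))) + s) + s := by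
          gcongr
      _ = _ := by
          rw [Measure.map_apply hi Metric.isOpen_thickening.measurableSet, two_mul, add_assoc]
  · have := left_measure_le_of_levyProkhorovEDist_lt hlp MeasurableSet.univ
    rw [Measure.map_apply hi MeasurableSet.univ, preimage_univ] at this
    refine this.trans ?_
    gcongr
    refine (measure_mono (subset_univ _)).trans_eq ?_
    rw [Measure.map_apply hj MeasurableSet.univ, preimage_univ]
  · rintro p q a b hp hq ⟨ha, hpa⟩ ⟨hb, hqb⟩ D hD hab
    have hp' : p ∈ Eᶜ := fun h => hp (subset_toMeasurable _ _ h)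
    have hq' : q ∈ Eᶜ := fun h => hq (subset_toMeasurable _ _ h)
    have hDL := hD.trans hLs
    have hj' := hjF a ha b hb (min_lt_of_right_lt (hab.trans_lt (le_self_add.trans_lt hDL)))
    -- The distance in `Z` is below `L`, so the isometry condition for `i` is triggered from the
    -- image side.
    have hle : edist (i p) (i q) ≤ D + 4 * s := by
      refine (htri hpa hqb).1.trans ?_
      rw [hj']; gcongr
    rwa [← hiE p hp' q hq' (min_lt_of_left_lt (hle.trans_lt hDL))]
  · rintro p q a b hp hq ⟨ha, hpa⟩ ⟨hb, hqb⟩ D hD hab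
    have hp' : p ∈ Eᶜ := fun h => hp (subset_toMeasurable _ _ h)
    have hq' : q ∈ Eᶜ := fun h => hq (subset_toMeasurable _ _ h)
    have hDL := hD.trans hLs
    have hi' := hiE p hp' q hq' (min_lt_of_right_lt (hab.trans_lt (le_self_add.trans_lt hDL)))
    have hle : edist (j a) (j b) ≤ D + 4 * s := by
      refine (htri hpa hqb).2.trans ?_
      rw [hi']; gcongr
    rwa [← hjF a ha b hb (min_lt_of_left_lt (hle.trans_lt hDL))]

/-- If `dRho (μn n) μ` tends to `0`, then there are approximate matchings with errors tending
to `0`. -/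
theorem exists_seq_isApproxMatching {X : Type*} {Xn : ℕ → Type*} [EMetricSpace X]
    [MeasurableSpace X] [∀ n, EMetricSpace (Xn n)] [∀ n, MeasurableSpace (Xn n)]
    {μ : Measure X} {μn : ∀ n, Measure (Xn n)}
    (h : Tendsto (fun n => dRho (μn n) μ) atTop (𝓝 0)) :
    ∃ (s : ℕ → ℝ≥0∞) (N : ∀ n, Xn n → X → Prop) (E : ∀ n, Set (Xn n)),
      Tendsto s atTop (𝓝 0) ∧ ∀ᶠ n in atTop, IsApproxMatching (s n) (μn n) μ (N n) (E n) := by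
  -- The summand `n⁻¹` makes the error strictly larger than `dRho`; the error is finite only
  -- eventually, so the default values chosen below do not matter.
  have hlim : Tendsto (fun n : ℕ => dRho (μn n) μ + (n : ℝ≥0∞)⁻¹) atTop (𝓝 0) := by
    simpa using h.add ENNReal.tendsto_inv_nat_nhds_zero
  have hev : ∀ᶠ n : ℕ in atTop, ∃ (N : Xn n → X → Prop) (E : Set (Xn n)),
      IsApproxMatching (dRho (μn n) μ + (n : ℝ≥0∞)⁻¹) (μn n) μ N E := by
    filter_upwards [hlim.eventually_lt_const ENNReal.zero_lt_top] with n hn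
    refine exists_isApproxMatching_of_dRho_lt hn.ne
      (ENNReal.lt_add_right (le_self_add.trans_lt hn).ne ?_)
    simp
  classical
  refine ⟨fun n : ℕ => dRho (μn n) μ + (n : ℝ≥0∞)⁻¹,
    fun n => if hn : ∃ (N : Xn n → X → Prop) (E : Set (Xn n)),
      IsApproxMatching (dRho (μn n) μ + (n : ℝ≥0∞)⁻¹) (μn n) μ N E
      then hn.choose else fun _ _ => True,
    fun n => if hn : ∃ (N : Xn n → X → Prop) (E : Set (Xn n)),
      IsApproxMatching (dRho (μn n) μ + (n : ℝ≥0∞)⁻¹) (μn n) μ N E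
      then hn.choose_spec.choose else ∅, hlim, ?_⟩
  filter_upwards [hev] with n hn
  simp only [dif_pos hn]
  exact hn.choose_spec.choose_spec

/-! ### The limit relation -/

/-- The points of `X'` that are matched with the first component of a point of `W` and whose
image under `f` is matched with its second component. -/
def jointlyMatched {X' Y' X Y : Type*} (N : X' → X → Prop) (N' : Y' → Y → Prop) (f : X' → Y')
    (W : Set (X × Y)) : Set X' :=
  {p | ∃ w ∈ W, N p w.1 ∧ N' (f p) w.2}

/-- The set `W` asymptotically matches no mass. -/
def IsAsymptoticallyNull {X Y : Type*} {Xn Yn : ℕ → Type*} [∀ n, MeasurableSpace (Xn n)]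
    (l : Filter ℕ) (μn : ∀ n, Measure (Xn n)) (N : ∀ n, Xn n → X → Prop)
    (N' : ∀ n, Yn n → Y → Prop) (f : ∀ n, Xn n → Yn n) (W : Set (X × Y)) : Prop :=
  Tendsto (fun n => μn n (jointlyMatched (N n) (N' n) (f n) W)) l (𝓝 0)

/-- The limit relation: the pairs all of whose neighbourhoods asymptotically match some mass. -/
def limitRelation {X Y : Type*} {Xn Yn : ℕ → Type*} [TopologicalSpace X] [TopologicalSpace Y]
    [∀ n, MeasurableSpace (Xn n)]
    (l : Filter ℕ) (μn : ∀ n, Measure (Xn n)) (N : ∀ n, Xn n → X → Prop)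
    (N' : ∀ n, Yn n → Y → Prop) (f : ∀ n, Xn n → Yn n) : Set (X × Y) :=
  {w | ∀ W ∈ 𝓝 w, ¬ IsAsymptoticallyNull l μn N N' f W}

section LimitRelation

variable {X Y : Type*} {Xn Yn : ℕ → Type*} [∀ n, MeasurableSpace (Xn n)]
  {l : Filter ℕ} {μn : ∀ n, Measure (Xn n)} {N : ∀ n, Xn n → X → Prop}
  {N' : ∀ n, Yn n → Y → Prop} {f : ∀ n, Xn n → Yn n}

theorem IsAsymptoticallyNull.mono {V W : Set (X × Y)} (hVW : V ⊆ W)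
    (hW : IsAsymptoticallyNull l μn N N' f W) : IsAsymptoticallyNull l μn N N' f V :=
  tendsto_of_tendsto_of_tendsto_of_le_of_le tendsto_const_nhds hW (fun _ => zero_le)
    fun _ => measure_mono fun _ ⟨w, hw, h⟩ => ⟨w, hVW hw, h⟩

theorem IsAsymptoticallyNull.union {V W : Set (X × Y)}
    (hV : IsAsymptoticallyNull l μn N N' f V) (hW : IsAsymptoticallyNull l μn N N' f W) :
    IsAsymptoticallyNull l μn N N' f (V ∪ W) := by
  have h := Tendsto.add hV hW
  rw [add_zero] at h
  refine tendsto_of_tendsto_of_tendsto_of_le_of_le tendsto_const_nhds h (fun _ => zero_le)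
    fun n => (measure_mono ?_).trans (measure_union_le _ _)
  rintro p ⟨w, hw | hw, h⟩
  · exact Or.inl ⟨w, hw, h⟩
  · exact Or.inr ⟨w, hw, h⟩

theorem isClosed_limitRelation [TopologicalSpace X] [TopologicalSpace Y] :
    IsClosed (limitRelation l μn N N' f) := by
  rw [← isOpen_compl_iff, isOpen_iff_mem_nhds]
  intro w hw
  simp only [limitRelation, mem_compl_iff, mem_ofPred_eq, not_forall, not_not] at hw
  obtain ⟨W, hW, hnull⟩ := hw
  filter_upwards [eventually_mem_nhds_iff.2 hW] with v hv hv'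
  exact hv' W hv hnull

theorem isAsymptoticallyNull_of_isCompact [TopologicalSpace X] [TopologicalSpace Y]
    {K : Set (X × Y)} (hK : IsCompact K) (hd : Disjoint K (limitRelation l μn N N' f)) :
    IsAsymptoticallyNull l μn N N' f K := by
  refine hK.induction_on (p := IsAsymptoticallyNull l μn N N' f) ?_
    (fun _ _ h => IsAsymptoticallyNull.mono h) (fun _ _ => IsAsymptoticallyNull.union) ?_
  · simpa [IsAsymptoticallyNull, jointlyMatched] using tendsto_const_nhds
  · intro w hw
    have := disjoint_left.1 hd hw
    simp only [limitRelation, mem_ofPred_eq, not_forall, not_not] at this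
    obtain ⟨W, hW, hnull⟩ := this
    exact ⟨W, mem_nhdsWithin_of_mem_nhds hW, hnull⟩

end LimitRelation

/-! ### Distances and masses in the limit -/

section Limit

variable {X Y : Type*} {Xn Yn : ℕ → Type*}
  [EMetricSpace X] [MeasurableSpace X] [EMetricSpace Y] [MeasurableSpace Y]
  [∀ n, EMetricSpace (Xn n)] [∀ n, MeasurableSpace (Xn n)]
  [∀ n, EMetricSpace (Yn n)] [∀ n, MeasurableSpace (Yn n)]
  {μ : Measure X} {ν : Measure Y} {μn : ∀ n, Measure (Xn n)} {νn : ∀ n, Measure (Yn n)}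
  {N : ∀ n, Xn n → X → Prop} {N' : ∀ n, Yn n → Y → Prop} {f : ∀ n, Xn n → Yn n}
  {E : ∀ n, Set (Xn n)} {F : ∀ n, Set (Yn n)} {s t : ℕ → ℝ≥0∞} {l : Filter ℕ}

/-- Small neighbourhoods of two points of the limit relation are jointly matched, outside the
exceptional sets, for arbitrarily large indices. -/
theorem eventually_exists_matched {l : Ultrafilter ℕ}
    (hμ : ∀ᶠ n in l, IsApproxMatching (s n) (μn n) μ (N n) (E n))
    (hν : ∀ᶠ n in l, IsApproxMatching (t n) (νn n) ν (N' n) (F n))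
    (hs : Tendsto s l (𝓝 0)) (ht : Tendsto t l (𝓝 0))
    (hf : ∀ n, MeasurePreserving (f n) (μn n) (νn n)) {w : X × Y}
    (hw : w ∈ limitRelation l μn N N' f) {W : Set (X × Y)} (hW : W ∈ 𝓝 w) :
    ∀ᶠ n in l, ∃ p, p ∉ E n ∧ f n p ∉ F n ∧ ∃ v ∈ W, N n p v.1 ∧ N' n (f n p) v.2 := by
  have h := hw W hW
  rw [IsAsymptoticallyNull, ENNReal.tendsto_nhds_zero] at h
  -- Along an ultrafilter, mass that is not eventually at most `c` is eventually above `c`; this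
  -- lets the conditions at two points hold at a common index.
  push Not at h
  obtain ⟨c, hc, hfreq⟩ := h
  have hst : Tendsto (fun n => s n + t n) l (𝓝 0) := by simpa using hs.add ht
  filter_upwards [hfreq, hst.eventually_lt_const hc, hμ, hν] with n hn hstn hμn hνn
  by_contra! hcon
  have hsub : jointlyMatched (N n) (N' n) (f n) W ⊆ E n ∪ f n ⁻¹' F n := by
    rintro p ⟨v, hv, h1, h2⟩
    by_contra hp
    rw [mem_union, not_or] at hp
    exact hcon p hp.1 hp.2 v hv h1 h2
  refine absurd (hn.trans_le ((measure_mono hsub).trans (measure_union_le _ _))) (not_lt.2 ?_)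
  rw [(hf n).measure_preimage hνn.measurableSet_bad.nullMeasurableSet]
  exact (add_le_add hμn.measure_bad_le hνn.measure_bad_le).trans hstn.le

/-- Near two points of the limit relation, distances in the two components control each other. -/
theorem exists_near_limitRelation {l : Ultrafilter ℕ}
    (hμ : ∀ᶠ n in l, IsApproxMatching (s n) (μn n) μ (N n) (E n))
    (hν : ∀ᶠ n in l, IsApproxMatching (t n) (νn n) ν (N' n) (F n))
    (hs : Tendsto s l (𝓝 0)) (ht : Tendsto t l (𝓝 0))
    (hf : ∀ n, MeasurePreserving (f n) (μn n) (νn n)) (hf' : ∀ n, Isometry (f n)) {v w : X × Y}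
    (hv : v ∈ limitRelation l μn N N' f) (hw : w ∈ limitRelation l μn N N' f)
    {δ D : ℝ≥0∞} (hδ : 0 < δ) (hδ' : δ ≠ ∞) (hD : D ≠ ∞) :
    ∃ v' w' : X × Y, edist v'.1 v.1 < δ ∧ edist v'.2 v.2 < δ ∧ edist w'.1 w.1 < δ ∧
      edist w'.2 w.2 < δ ∧ (edist v'.1 w'.1 ≤ D + 2 * δ → edist v'.2 w'.2 ≤ D + 4 * δ) ∧
      (edist v'.2 w'.2 ≤ D + 2 * δ → edist v'.1 w'.1 ≤ D + 4 * δ) := by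
  have hnhds : ∀ u : X × Y, Metric.eball u.1 δ ×ˢ Metric.eball u.2 δ ∈ 𝓝 u := fun u =>
    prod_mem_nhds (Metric.eball_mem_nhds _ hδ) (Metric.eball_mem_nhds _ hδ)
  have hfin : D + 4 * δ < ∞ := ENNReal.add_lt_top.2 ⟨hD.lt_top,
    ENNReal.mul_lt_top (by simp) hδ'.lt_top⟩
  have hsmall : ∀ r : ℕ → ℝ≥0∞, Tendsto r l (𝓝 0) →
      ∀ᶠ n in l, 4 * r n < δ ∧ D + 4 * δ < (r n)⁻¹ := by
    intro r hr
    have h4 : Tendsto (fun n => 4 * r n) l (𝓝 0) := by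
      simpa using ENNReal.Tendsto.const_mul hr (Or.inr (by simp : (4 : ℝ≥0∞) ≠ ∞))
    have hinv : Tendsto (fun n => (r n)⁻¹) l (𝓝 ∞) := by
      simpa using tendsto_inv_iff.2 hr
    exact (h4.eventually_lt_const hδ).and (hinv.eventually_const_lt hfin)
  obtain ⟨n, ⟨p, hpE, hpF, v', hv', hpv, hpv'⟩, ⟨q, hqE, hqF, w', hw', hqw, hqw'⟩,
    ⟨hs1, hs2⟩, ⟨ht1, ht2⟩, hμn, hνn⟩ :=
    ((eventually_exists_matched hμ hν hs ht hf hv (hnhds v)).and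
      ((eventually_exists_matched hμ hν hs ht hf hw (hnhds w)).and
      ((hsmall s hs).and ((hsmall t ht).and (hμ.and hν))))).exists
  have e3 : D + 2 * δ + δ = D + 3 * δ := by ring
  have e4 : D + 3 * δ + δ = D + 4 * δ := by ring
  have h34 : D + 3 * δ ≤ D + 4 * δ := e4 ▸ le_self_add
  have b2 : ∀ {r : ℝ≥0∞}, 4 * r < δ → D + 2 * δ + 4 * r ≤ D + 3 * δ := fun h =>
    (add_le_add le_rfl h.le).trans_eq e3
  have b3 : ∀ {r : ℝ≥0∞}, 4 * r < δ → D + 3 * δ + 4 * r ≤ D + 4 * δ := fun h =>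
    (add_le_add le_rfl h.le).trans_eq e4
  refine ⟨v', w', hv'.1, hv'.2, hw'.1, hw'.2, fun h => ?_, fun h => ?_⟩
  · have h1 := (hμn.edist_le_left p q _ _ hpE hqE hpv hqw _
      (((b2 hs1).trans h34).trans_lt hs2) h).trans (b2 hs1)
    rw [← hf' n p q] at h1
    exact (hνn.edist_le_right _ _ _ _ hpF hqF hpv' hqw' _ ((b3 ht1).trans_lt ht2) h1).trans
      (b3 ht1)
  · have h1 := (hνn.edist_le_left _ _ _ _ hpF hqF hpv' hqw' _
      (((b2 ht1).trans h34).trans_lt ht2) h).trans (b2 ht1)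
    rw [hf' n p q] at h1
    exact (hμn.edist_le_right _ _ _ _ hpE hqE hpv hqw _ ((b3 hs1).trans_lt hs2) h1).trans
      (b3 hs1)

theorem edist_le_of_edist_lt {Z : Type*} [EMetricSpace Z] {a b a' b' : Z} {δ D : ℝ≥0∞}
    (ha : edist a' a < δ) (hb : edist b' b < δ) (hab : edist a b ≤ D) :
    edist a' b' ≤ D + 2 * δ :=
  calc edist a' b' ≤ edist a' a + edist a b + edist b b' := edist_triangle4 _ _ _ _
    _ ≤ δ + D + δ := by rw [edist_comm b]; gcongr
    _ = _ := by ring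

theorem edist_fst_eq_edist_snd_of_mem_limitRelation {l : Ultrafilter ℕ}
    (hμ : ∀ᶠ n in l, IsApproxMatching (s n) (μn n) μ (N n) (E n))
    (hν : ∀ᶠ n in l, IsApproxMatching (t n) (νn n) ν (N' n) (F n))
    (hs : Tendsto s l (𝓝 0)) (ht : Tendsto t l (𝓝 0))
    (hf : ∀ n, MeasurePreserving (f n) (μn n) (νn n)) (hf' : ∀ n, Isometry (f n)) {v w : X × Y}
    (hv : v ∈ limitRelation l μn N N' f) (hw : w ∈ limitRelation l μn N N' f) :
    edist v.1 w.1 = edist v.2 w.2 := by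
  -- The total loss is `6 * δ`: `4 * δ` from the comparison and `2 * δ` for returning to the
  -- original points.
  have e6 : ∀ (D : ℝ≥0∞) (ε : ℝ≥0), D + 4 * ((ε / 6 : ℝ≥0) : ℝ≥0∞) +
      2 * ((ε / 6 : ℝ≥0) : ℝ≥0∞) = D + ε := by
    intro D ε
    rw [add_assoc, ← add_mul]
    congr 1
    norm_cast
    field_simp
    ring
  apply le_antisymm
  · refine ENNReal.le_of_forall_pos_le_add fun ε hε hD => ?_
    obtain ⟨v', w', h1, h2, h3, h4, -, h6⟩ := exists_near_limitRelation hμ hν hs ht hf hf' hv hw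
      (δ := (ε / 6 : ℝ≥0)) (D := edist v.2 w.2) (by positivity) ENNReal.coe_ne_top hD.ne
    rw [edist_comm] at h1 h3
    exact (edist_le_of_edist_lt h1 h3 (h6 (edist_le_of_edist_lt h2 h4 le_rfl))).trans_eq (e6 _ _)
  · refine ENNReal.le_of_forall_pos_le_add fun ε hε hD => ?_
    obtain ⟨v', w', h1, h2, h3, h4, h6, -⟩ := exists_near_limitRelation hμ hν hs ht hf hf' hv hw
      (δ := (ε / 6 : ℝ≥0)) (D := edist v.1 w.1) (by positivity) ENNReal.coe_ne_top hD.ne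
    rw [edist_comm] at h2 h4
    exact (edist_le_of_edist_lt h2 h4 (h6 (edist_le_of_edist_lt h1 h3 le_rfl))).trans_eq (e6 _ _)

theorem measure_univ_le_of_isApproxMatching [NeBot l]
    (hμ : ∀ᶠ n in l, IsApproxMatching (s n) (μn n) μ (N n) (E n))
    (hν : ∀ᶠ n in l, IsApproxMatching (t n) (νn n) ν (N' n) (F n))
    (hs : Tendsto s l (𝓝 0)) (ht : Tendsto t l (𝓝 0))
    (hm : ∀ n, μn n univ = νn n univ) : ν univ ≤ μ univ := by
  have hlim : Tendsto (fun n => μ univ + s n + 2 * t n) l (𝓝 (μ univ)) := by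
    simpa using (tendsto_const_nhds.add hs).add
      (ENNReal.Tendsto.const_mul ht (Or.inr (by simp : (2 : ℝ≥0∞) ≠ ∞)))
  refine ge_of_tendsto hlim ?_
  filter_upwards [hμ, hν] with n hμn hνn
  refine (hνn.measure_le_matched univ).trans ?_
  gcongr
  refine (measure_mono (subset_univ _)).trans ?_
  rw [← hm]
  exact hμn.measure_univ_le

/-- A point matched with `C` is either jointly matched with `C ×ˢ K`, which is asymptotically
negligible, or sent by `f n` outside the set `T` matched with `K`. So `μ C` is nearly bounded by the
mass of `Tᶜ`, and `ν K` by that of `T`. -/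
theorem measure_add_measure_le_of_isCompact [NeBot l] [∀ n, IsFiniteMeasure (νn n)]
    (hμ : ∀ᶠ n in l, IsApproxMatching (s n) (μn n) μ (N n) (E n))
    (hν : ∀ᶠ n in l, IsApproxMatching (t n) (νn n) ν (N' n) (F n))
    (hs : Tendsto s l (𝓝 0)) (ht : Tendsto t l (𝓝 0))
    (hf : ∀ n, MeasurePreserving (f n) (μn n) (νn n))
    {C : Set X} (hC : IsCompact C) {K : Set Y} (hK : IsCompact K)
    (hd : Disjoint (C ×ˢ K) (limitRelation l μn N N' f)) : μ C + ν K ≤ ν univ := by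
  have hnull : Tendsto (fun n => μn n (jointlyMatched (N n) (N' n) (f n) (C ×ˢ K))) l (𝓝 0) :=
    isAsymptoticallyNull_of_isCompact (hC.prod hK) hd
  have h2 : (2 : ℝ≥0∞) ≠ ∞ := by simp
  have hlim : Tendsto (fun n => μn n (jointlyMatched (N n) (N' n) (f n) (C ×ˢ K)) + 2 * s n +
      (ν univ + t n + 2 * t n)) l (𝓝 (ν univ)) := by
    simpa using (hnull.add (ENNReal.Tendsto.const_mul hs (Or.inr h2))).add
      ((tendsto_const_nhds.add ht).add (ENNReal.Tendsto.const_mul ht (Or.inr h2)))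
  refine ge_of_tendsto hlim ?_
  filter_upwards [hμ, hν] with n hμn hνn
  set T := {p | ∃ a ∈ K, N' n p a} with hT
  have hTm : MeasurableSet T := hνn.measurableSet_matched K
  have hsub : {p | ∃ a ∈ C, N n p a} ⊆
      jointlyMatched (N n) (N' n) (f n) (C ×ˢ K) ∪ f n ⁻¹' Tᶜ := by
    rintro p ⟨a, ha, hpa⟩
    by_cases hp : f n p ∈ T
    · obtain ⟨b, hb, hpb⟩ := hp
      exact Or.inl ⟨(a, b), ⟨ha, hb⟩, hpa, hpb⟩
    · exact Or.inr hp
  have h1 : μ C ≤ μn n (jointlyMatched (N n) (N' n) (f n) (C ×ˢ K)) + νn n Tᶜ + 2 * s n := by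
    refine (hμn.measure_le_matched C).trans ?_
    gcongr
    refine (measure_mono hsub).trans ((measure_union_le _ _).trans_eq ?_)
    rw [(hf n).measure_preimage hTm.compl.nullMeasurableSet]
  calc μ C + ν K ≤ (μn n (jointlyMatched (N n) (N' n) (f n) (C ×ˢ K)) + νn n Tᶜ + 2 * s n) +
        (νn n T + 2 * t n) := add_le_add h1 (hνn.measure_le_matched K)
    _ = μn n (jointlyMatched (N n) (N' n) (f n) (C ×ˢ K)) + 2 * s n +
        ((νn n T + νn n Tᶜ) + 2 * t n) := by ring
    _ ≤ _ := by
        rw [measure_add_measure_compl hTm]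
        gcongr
        exact hνn.measure_univ_le

end Limit

/-! ### From the relation to an almost everywhere defined isometry -/

/-- A closed relation that preserves distances, and whose sections bound the measure of compact
sets, is the graph of a measure preserving isometry defined almost everywhere. -/
theorem exists_measurePreserving_isometry_of_relation {X Y : Type*}
    [EMetricSpace X] [MeasurableSpace X] [BorelSpace X]
    [CompleteSpace X] [TopologicalSpace.SeparableSpace X]
    [EMetricSpace Y] [MeasurableSpace Y] [BorelSpace Y] [CompleteSpace Y]
    (μ : Measure X) [IsFiniteMeasure μ] (ν : Measure Y) [IsFiniteMeasure ν]
    {S : Set (X × Y)} (hS : IsClosed S)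
    (hdist : ∀ v ∈ S, ∀ w ∈ S, edist v.1 w.1 = edist v.2 w.2)
    (hle : ∀ C : Set X, IsCompact C → μ C ≤ ν {y | ∃ x ∈ C, (x, y) ∈ S})
    (huniv : ν univ ≤ μ univ) :
    ∃ N : Set X, MeasurableSet N ∧ μ N = 0 ∧
      ∃ g : (Nᶜ : Set X) → Y,
        Isometry g ∧ MeasurePreserving g (μ.comap (Subtype.val : (Nᶜ : Set X) → X)) ν := by
  have : SecondCountableTopology X := UniformSpace.secondCountable_of_separable X
  -- The product distance is a maximum of two equal terms on `S`, so the first projection is an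
  -- isometry from the complete space `S` and has closed range.
  have hDclosed : IsClosed (Prod.fst '' S) := by
    have hiso : Isometry (fun w : S => w.1.1) := by
      intro v w
      rw [Subtype.edist_eq, Prod.edist_eq, ← hdist v v.2 w w.2, max_self]
    have : CompleteSpace S := hS.completeSpace_coe
    have := hiso.isClosedEmbedding.isClosed_range
    rwa [range_comp' Prod.fst Subtype.val, Subtype.range_coe] at this
  set D := Prod.fst '' S with hD
  have hbound : ∀ (A : Set X) (B : Set Y), MeasurableSet A →
      (∀ x ∈ A, ∀ y, (x, y) ∈ S → y ∈ B) → μ A ≤ ν B := by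
    intro A B hA hAB
    -- A finite measure on a complete separable space is inner regular for compact sets, which
    -- extends `hle` to measurable sets.
    rw [hA.measure_eq_iSup_isCompact_of_ne_top (measure_ne_top μ A)]
    refine iSup_le fun C => iSup_le fun hCA => iSup_le fun hC => ?_
    exact (hle C hC).trans (measure_mono fun y ⟨x, hx, hxy⟩ => hAB x (hCA hx) y hxy)
  have hnull : μ Dᶜ = 0 := by
    refine le_antisymm ((hbound Dᶜ ∅ hDclosed.measurableSet.compl ?_).trans_eq measure_empty)
      zero_le
    exact fun x hx y hxy => hx ⟨_, hxy, rfl⟩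
  have hex : ∀ x : (Dᶜᶜ : Set X), ∃ y, ((x : X), y) ∈ S := by
    rintro ⟨x, hx⟩
    rw [compl_compl] at hx
    obtain ⟨⟨x, y⟩, hw, rfl⟩ := hx
    exact ⟨y, hw⟩
  choose g hg using hex
  have hgiso : Isometry g := fun x x' => (hdist _ (hg x) _ (hg x')).symm
  have hgm : Measurable g := hgiso.continuous.measurable
  have hDm : MeasurableSet (Dᶜᶜ : Set X) := hDclosed.measurableSet.compl.compl
  refine ⟨Dᶜ, hDclosed.measurableSet.compl, hnull, g, hgiso, hgm, ?_⟩
  have hemb := MeasurableEmbedding.subtype_coe hDm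
  have hcomap : ∀ A, (μ.comap (Subtype.val : (Dᶜᶜ : Set X) → X)) A = μ (Subtype.val '' A) :=
    hemb.comap_apply μ
  have hfin : IsFiniteMeasure (μ.comap (Subtype.val : (Dᶜᶜ : Set X) → X)) :=
    ⟨by rw [hcomap]; exact measure_lt_top _ _⟩
  -- Domination between finite measures of equal total mass is equality.
  refine Measure.eq_of_le_of_measure_univ_eq (Measure.le_iff.2 fun B hB => ?_) ?_
  · rw [Measure.map_apply hgm hB, hcomap]
    refine hbound _ _ (hemb.measurableSet_image.2 (hgm hB)) ?_
    rintro _ ⟨x, hx, rfl⟩ y hxy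
    -- The relation is single-valued: equal first components force second components at distance
    -- `0`.
    have hgy := hdist _ (hg x) _ hxy
    rw [edist_self, eq_comm, edist_eq_zero] at hgy
    change g x = y at hgy
    exact hgy ▸ hx
  · refine le_antisymm ?_ ?_
    · rw [Measure.map_apply hgm MeasurableSet.univ, hcomap]
      refine hbound _ _ (hemb.measurableSet_image.2 (hgm MeasurableSet.univ)) ?_
      exact fun _ _ y _ => mem_univ y
    · rw [Measure.map_apply hgm MeasurableSet.univ, preimage_univ, hcomap, image_univ,
        Subtype.range_coe, compl_compl]
      refine huniv.trans ?_
      rw [← measure_add_measure_compl hDclosed.measurableSet, hnull, add_zero]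

/-- Projection along a compact factor is a closed map. This makes the section over a compact set
Borel. -/
theorem isClosed_section_of_isCompact {X Y : Type*} [TopologicalSpace X] [TopologicalSpace Y]
    {S : Set (X × Y)} (hS : IsClosed S) {C : Set X} (hC : IsCompact C) :
    IsClosed {y | ∃ x ∈ C, (x, y) ∈ S} := by
  have : CompactSpace C := isCompact_iff_compactSpace.1 hC
  have hcl : IsClosed ((fun w : C × Y => ((w.1 : X), w.2)) ⁻¹' S) :=
    hS.preimage (by fun_prop)
  convert isClosedMap_snd_of_compactSpace _ hcl using 1
  ext y
  simp

/-! ### The main theorem -/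

theorem mainTheorem8
    {X Y : Type*} {Xn Yn : ℕ → Type*}
    [EMetricSpace X] [MeasurableSpace X] [BorelSpace X]
    [CompleteSpace X] [TopologicalSpace.SeparableSpace X]
    [EMetricSpace Y] [MeasurableSpace Y] [BorelSpace Y]
    [CompleteSpace Y] [TopologicalSpace.SeparableSpace Y]
    [∀ n, EMetricSpace (Xn n)] [∀ n, MeasurableSpace (Xn n)] [∀ n, BorelSpace (Xn n)]
    [∀ n, EMetricSpace (Yn n)] [∀ n, MeasurableSpace (Yn n)] [∀ n, BorelSpace (Yn n)]
    (μ : Measure X) [IsFiniteMeasure μ] (ν : Measure Y) [IsFiniteMeasure ν]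
    (μn : ∀ n, Measure (Xn n)) [∀ n, IsFiniteMeasure (μn n)]
    (νn : ∀ n, Measure (Yn n)) [∀ n, IsFiniteMeasure (νn n)]
    (hX : Tendsto (fun n => dRho (μn n) μ) atTop (𝓝 0))
    (hY : Tendsto (fun n => dRho (νn n) ν) atTop (𝓝 0))
    (f : ∀ n, Xn n → Yn n)
    (hf : ∀ n, Isometry (f n) ∧ MeasurePreserving (f n) (μn n) (νn n)) :
    ∃ N : Set X, MeasurableSet N ∧ μ N = 0 ∧
      ∃ g : (Nᶜ : Set X) → Y,
        Isometry g ∧ MeasurePreserving g (μ.comap (Subtype.val : (Nᶜ : Set X) → X)) ν := by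
  have : SecondCountableTopology Y := UniformSpace.secondCountable_of_separable Y
  obtain ⟨s, N, E, hs, hμ⟩ := exists_seq_isApproxMatching hX
  obtain ⟨t, N', F, ht, hν⟩ := exists_seq_isApproxMatching hY
  -- The ultrafilter plays the role of passing to subsequences.
  let l : Ultrafilter ℕ := hyperfilter ℕ
  have hl : (l : Filter ℕ) ≤ atTop := Nat.hyperfilter_le_atTop
  replace hs := hs.mono_left hl
  replace ht := ht.mono_left hl
  replace hμ := hμ.filter_mono hl
  replace hν := hν.filter_mono hl
  have hS : IsClosed (limitRelation (l : Filter ℕ) μn N N' f) := isClosed_limitRelation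
  refine exists_measurePreserving_isometry_of_relation μ ν hS
    (fun v hv w hw => edist_fst_eq_edist_snd_of_mem_limitRelation hμ hν hs ht
      (fun n => (hf n).2) (fun n => (hf n).1) hv hw) (fun C hC => ?_)
    (measure_univ_le_of_isApproxMatching hμ hν hs ht fun n => by
      simpa using (hf n).2.measure_preimage MeasurableSet.univ.nullMeasurableSet)
  set B := {y | ∃ x ∈ C, (x, y) ∈ limitRelation (l : Filter ℕ) μn N N' f} with hB
  have hBm : MeasurableSet B := (isClosed_section_of_isCompact hS hC).measurableSet
  refine ENNReal.le_of_forall_pos_le_add fun ε hε _ => ?_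
  -- A compact `K` exhausting `Bᶜ` up to `ε` gives a rectangle `C ×ˢ K` that misses the relation, by
  -- the definition of `B`.
  obtain ⟨K, hKB, hK, hKε⟩ := hBm.compl.exists_isCompact_lt_add (μ := ν)
    (measure_ne_top ν _) (ENNReal.coe_ne_zero.2 hε.ne')
  have hd : Disjoint (C ×ˢ K) (limitRelation (l : Filter ℕ) μn N N' f) :=
    disjoint_left.2 fun w hw hwS => hKB hw.2 ⟨w.1, hw.1, hwS⟩
  have h := measure_add_measure_le_of_isCompact hμ hν hs ht (fun n => (hf n).2) hC hK hd
  rw [← ENNReal.add_le_add_iff_right (measure_ne_top ν K)]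
  calc μ C + ν K ≤ ν univ := h
    _ = ν B + ν Bᶜ := (measure_add_measure_compl hBm).symm
    _ ≤ ν B + (ν K + ε) := by gcongr
    _ = ν B + ε + ν K := by ring
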